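/- Let $\mathtt C$ be a $*$-autonomous category: a symmetric monoidal closed category with tensor product $\otimes$, unit $\mathbf 1$ and a dualizing object $\bot$, with duals $c^*=[c,\bot]$ (so $\mathbf 1^*\cong\bot$). Let $\mathcal S\colon\mathtt C\to\mathtt{FVec}$ be a stem, i.e. a $*$-autonomous functor to finite-dimensional real vector spaces: a strong symmetric monoidal functor (in particular $\mathcal S(\mathbf 1)\cong\mathbb R$) together with an identification $\mathcal S(\bot)\cong\mathbb R$ such that for every $c\in\mathtt C$ the bilinear map $\mathcal S(c^*)\times\mathcal S(c)\to\mathcal S(c\otimes c^*)\to\mathcal S(\bot)\cong\mathbb R$ induced by evaluation is a perfect pairing. For $c\in\mathtt C$ let $$A(c)=\{v\in\mathcal S(c)\mid \mathcal S(\varphi)(v)\geqslant 0\ \text{ for all }\varphi\in\mathtt C(c,\bot)\}$$ be the intrinsic cone. Assume that every $A(c)$ is proper (closed, sharp, i.e. $A(c)\cap -A(c)=\{0\}$, and with nonempty interior), and that the sign of the identification $\mathcal S(\bot)\cong\mathbb R$ is normalized so that $1\in A(\mathbf 1)$, i.e. $\mathcal S(\varphi)(1)\geqslant 0$ for all $\varphi\in\mathtt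 C(\mathbf 1,\bot)$, where $1\in\mathbb R\cong\mathcal S(\mathbf 1)$. Let $X$ be a finite-dimensional real vector space with a fixed basis, and let $\langle\cdot,\cdot\rangle$ be the inner product on $X$ for which this basis is orthonormal. An $\mathcal S$-system $\mathcal G$ on $X$ assigns to every $c\in\mathtt C$ a closed convex cone $\mathcal G(c)\subseteq X\otimes\mathcal S(c)$ such that $(\mathrm{id}_X\otimes\mathcal S(\varphi))(\mathcal G(c))\subseteq\mathcal G(d)$ for all $\varphi\in\mathtt C(c,d)$; inclusion of systems is meant level-wise. The dual system $\mathcal G^\vee$ is the level-wise dual $\mathcal G^\vee(c)=\mathcal G(c^*)^\vee$, i.e. the set of all $y\in X\otimes\mathcal S(c)$ that pair nonnegatively with all elements of $\mathcal G(c^*)\subseteq X\otimes\mathcal S(c^*)$, with respect to the tensor product of $\langle\cdot,\cdot\rangle$ and the pairing of $\mathcal S(c^*)$ with $\mathcal S(c)$. Let $\mathcal G$ be an $\mathcal S$-system on $X$ with $\mathcal G\subseteq\mathcal G^\vee$. Then there exists an $\mathcal S$-system $\mathcal E$ on $X$ with $$\mathcal G\subseteq\mathcal E=\mathcal E^\vee\subseteq\mathcal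 G^\vee.$$ -/

import Mathlib

open CategoryTheory MonoidalCategory TensorProduct

noncomputable section

namespace ConeSys

universe v u w

/-! ### Cones in finite-dimensional real vector spaces -/

/-- A set in a real vector space is closed. On a finite-dimensional space the module topology is
the usual (unique Hausdorff vector space) topology. -/
def IsClosedIn {V : Type w} [AddCommGroup V] [Module ℝ V] (s : Set V) : Prop :=
  @IsClosed V (moduleTopology ℝ V) s

/-- A convex cone is proper if it is closed, sharp and has nonempty interior. -/
structure IsProperCone {V : Type w} [AddCommGroup V] [Module ℝ V] (K : PointedCone ℝ V) :
    Prop where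
  closed : IsClosedIn (K : Set V)
  sharp : ∀ v : V, v ∈ K → -v ∈ K → v = 0
  interior_nonempty : (@interior V (moduleTopology ℝ V) (K : Set V)).Nonempty

/-! ### Star-autonomous categories -/

section StarAutonomous

variable {C : Type u} [Category.{v} C] [MonoidalCategory C] [SymmetricCategory C]
  [MonoidalClosed C]

/-- The canonical morphism `c ⟶ [[c, b], b]`, obtained by currying
`[c, b] ⊗ c ≅ c ⊗ [c, b] ⟶ b`. -/
def toBidual (b c : C) : c ⟶ (ihom ((ihom c).obj b)).obj b :=
  MonoidalClosed.curry ((β_ ((ihom c).obj b) c).hom ≫ (ihom.ev c).app b)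

end StarAutonomous

/-- A star-autonomous category: a symmetric monoidal closed category with a dualizing object `bot`,
i.e. all canonical morphisms `c ⟶ [[c, bot], bot]` are isomorphisms. -/
class StarAutonomousCategory (C : Type u) [Category.{v} C] [MonoidalCategory C]
    [SymmetricCategory C] [MonoidalClosed C] where
  /-- the dualizing object, canonically isomorphic to the dual of the monoidal unit -/
  bot : C
  isIso_toBidual : ∀ c : C, IsIso (toBidual bot c)

section StarAutonomous

variable {C : Type u} [Category.{v} C] [MonoidalCategory C] [SymmetricCategory C]
  [MonoidalClosed C] [StarAutonomousCategory C]

/-- The dualizing object. -/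
abbrev bot (C : Type u) [Category.{v} C] [MonoidalCategory C] [SymmetricCategory C]
    [MonoidalClosed C] [StarAutonomousCategory C] : C :=
  StarAutonomousCategory.bot

/-- The dual object `c* = [c, bot]`. -/
abbrev star (c : C) : C := (ihom c).obj (bot C)

/-- The dual morphism `φ* : d* ⟶ c*` of `φ : c ⟶ d`. -/
abbrev starMap {c d : C} (φ : c ⟶ d) : star d ⟶ star c := (MonoidalClosed.pre φ).app (bot C)

/-- The evaluation `c ⊗ c* ⟶ bot`. -/
abbrev starEv (c : C) : c ⊗ star c ⟶ bot C := (ihom.ev c).app (bot C)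

/-- For a monoidal functor `F` to vector spaces and a linear form `e` on `F bot`, the bilinear map
`F (c*) × F c ⟶ F (c ⊗ c*) ⟶ F bot ⟶ ℝ`. -/
def starPairing (F : C ⥤ FGModuleCat.{0} ℝ) [F.LaxMonoidal] (e : F.obj (bot C) →ₗ[ℝ] ℝ) (c : C) :
    F.obj (star c) →ₗ[ℝ] F.obj c →ₗ[ℝ] ℝ :=
  ((TensorProduct.mk ℝ (F.obj c) (F.obj (star c))).compr₂
    (e ∘ₗ (F.map (starEv c)).hom.hom ∘ₗ
      (Functor.LaxMonoidal.μ F c (star c)).hom.hom)).flip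

end StarAutonomous

/-! ### Stems -/

/-- A stem: a star-autonomous functor from a star-autonomous category to finite-dimensional real
vector spaces, i.e. a strong symmetric monoidal functor together with an identification of the
image of the dualizing object with `ℝ`, such that the canonical maps `S (c*) ⟶ (S c)'` are
isomorphisms. -/
structure Stem (C : Type u) [Category.{v} C] [MonoidalCategory C] [SymmetricCategory C]
    [MonoidalClosed C] [StarAutonomousCategory C] where
  functor : C ⥤ FGModuleCat.{0} ℝ
  braided : functor.Braided
  botEquiv : functor.obj (bot C) ≃ₗ[ℝ] ℝ
  bijective_pairing : ∀ c : C, Function.Bijective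
    (starPairing functor (botEquiv : functor.obj (bot C) →ₗ[ℝ] ℝ) c)

section Systems

variable {C : Type u} [Category.{v} C] [MonoidalCategory C] [SymmetricCategory C]
  [MonoidalClosed C] [StarAutonomousCategory C]

namespace Stem

attribute [instance] Stem.braided

variable (S : Stem C)

/-- The vector space `S c`. -/
abbrev obj (c : C) : Type := S.functor.obj c

/-- The linear map `S φ`. -/
abbrev map {c d : C} (φ : c ⟶ d) : S.obj c →ₗ[ℝ] S.obj d := (S.functor.map φ).hom.hom

/-- The element of `S 𝟙` corresponding to `1 : ℝ` under the identification `S 𝟙 ≅ ℝ`. -/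
def one : S.obj (𝟙_ C) := (Functor.LaxMonoidal.ε S.functor).hom.hom (1 : ℝ)

/-- The duality pairing of `S (c*)` and `S c`. -/
def pairing (c : C) : S.obj (star c) →ₗ[ℝ] S.obj c →ₗ[ℝ] ℝ :=
  starPairing S.functor (S.botEquiv : S.obj (bot C) →ₗ[ℝ] ℝ) c

/-- The intrinsic cone `A c ⊆ S c`: all vectors that every morphism from `c` to the dualizing
object maps to a nonnegative number. -/
def intrinsicCone (c : C) : PointedCone ℝ (S.obj c) where
  carrier := {v | ∀ φ : c ⟶ bot C, 0 ≤ S.botEquiv (S.map φ v)}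
  zero_mem' := by intro φ; simp
  add_mem' := by
    intro a b ha hb φ
    rw [map_add, map_add]
    exact add_nonneg (ha φ) (hb φ)
  smul_mem' := by
    intro r a ha φ
    have h : r • a = (r : ℝ) • a := rfl
    rw [h, map_smul, map_smul]
    exact mul_nonneg r.2 (ha φ)

/-- Naturality of the duality pairing: `⟨u, S φ v⟩ = ⟨S φ* u, v⟩`. -/
theorem pairing_map {c d : C} (φ : c ⟶ d) (u : S.obj (star d)) (v : S.obj c) :
    S.pairing d u (S.map φ v) = S.pairing c (S.map (starMap φ) u) v := by
  have h1 : c ◁ starMap φ ≫ starEv c = φ ▷ star d ≫ starEv d :=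
    MonoidalClosed.id_tensor_pre_app_comp_ev φ (bot C)
  have h2 : (S.functor.obj c ◁ S.functor.map (starMap φ)) ≫
      Functor.LaxMonoidal.μ S.functor c (star c) ≫ S.functor.map (starEv c) =
      (S.functor.map φ ▷ S.functor.obj (star d)) ≫
        Functor.LaxMonoidal.μ S.functor d (star d) ≫ S.functor.map (starEv d) := by
    rw [Functor.LaxMonoidal.μ_natural_left_assoc, Functor.LaxMonoidal.μ_natural_right_assoc,
      ← Functor.map_comp, ← Functor.map_comp, h1]
  have h3 := congrArg (fun f => S.botEquiv (f.hom.hom (v ⊗ₜ[ℝ] u))) h2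
  exact h3.symm

end Stem

variable (S : Stem C) (X : Type w) [AddCommGroup X] [Module ℝ X]

/-- An `S`-system on `X`: closed convex cones in all spaces `X ⊗ S c`, such that all maps
`id ⊗ S φ` are positive. -/
@[ext]
structure ConeSystem where
  cone : ∀ c : C, PointedCone ℝ (X ⊗[ℝ] S.obj c)
  isClosed_cone : ∀ c : C, IsClosedIn (cone c : Set (X ⊗[ℝ] S.obj c))
  map_mem : ∀ {c d : C} (φ : c ⟶ d) (x : X ⊗[ℝ] S.obj c), x ∈ cone c →
    (S.map φ).lTensor X x ∈ cone d

variable {S X}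

/-- Level-wise inclusion of systems. -/
instance : LE (ConeSystem S X) := ⟨fun G H => ∀ c : C, G.cone c ≤ H.cone c⟩

variable {d : ℕ} (b : Module.Basis (Fin d) ℝ X)

/-- The pairing of `X ⊗ S (c*)` and `X ⊗ S c` given by
`⟨x ⊗ u, y ⊗ v⟩ = ⟨x, y⟩ ⟨u, v⟩`, where `⟨x, y⟩` is the inner product on `X` that
makes the basis `b` orthonormal. -/
def tensorPairing (S : Stem C) (c : C) :
    X ⊗[ℝ] S.obj (star c) →ₗ[ℝ] X ⊗[ℝ] S.obj c →ₗ[ℝ] ℝ :=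
  (TensorProduct.map₂ b.toDual (S.pairing c)).compr₂ (TensorProduct.lid ℝ ℝ).toLinearMap

theorem tensorPairing_tmul (S : Stem C) (c : C) (x y : X) (u : S.obj (star c)) (v : S.obj c) :
    tensorPairing b S c (x ⊗ₜ u) (y ⊗ₜ v) = b.toDual x y * S.pairing c u v := by
  simp [tensorPairing]

theorem tensorPairing_map (S : Stem C) {c e : C} (φ : c ⟶ e) (z : X ⊗[ℝ] S.obj (star e))
    (y : X ⊗[ℝ] S.obj c) :
    tensorPairing b S e z ((S.map φ).lTensor X y) =
      tensorPairing b S c ((S.map (starMap φ)).lTensor X z) y := by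
  induction z using TensorProduct.induction_on with
  | zero => simp
  | add z₁ z₂ h₁ h₂ => simp only [map_add, LinearMap.add_apply, h₁, h₂]
  | tmul x u =>
    induction y using TensorProduct.induction_on with
    | zero => simp
    | add y₁ y₂ h₁ h₂ => simp only [map_add, h₁, h₂]
    | tmul y v =>
      rw [LinearMap.lTensor_tmul, LinearMap.lTensor_tmul, tensorPairing_tmul, tensorPairing_tmul,
        Stem.pairing_map]

/-- The dual system, the level-wise dual `G^∨ c = (G (c*))^∨`, where `(X ⊗ S (c*))'` is
identified with `X ⊗ S c` through the basis `b` and the duality of `S (c*)` and `S c`. -/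
def ConeSystem.dual (G : ConeSystem S X) : ConeSystem S X where
  cone c :=
    { carrier := {y | ∀ z ∈ G.cone (star c), 0 ≤ tensorPairing b S c z y}
      zero_mem' := by intro z _; simp
      add_mem' := by
        intro y₁ y₂ h₁ h₂ z hz
        rw [map_add]
        exact add_nonneg (h₁ z hz) (h₂ z hz)
      smul_mem' := by
        intro r y hy z hz
        have h : r • y = (r : ℝ) • y := rfl
        rw [h, map_smul]
        exact mul_nonneg r.2 (hy z hz) }
  isClosed_cone c := by
    let _ : TopologicalSpace (X ⊗[ℝ] S.obj c) := moduleTopology ℝ _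
    have : IsModuleTopology ℝ (X ⊗[ℝ] S.obj c) := ⟨rfl⟩
    have h : {y | ∀ z ∈ G.cone (star c), 0 ≤ tensorPairing b S c z y} =
        ⋂ z ∈ G.cone (star c), {y | 0 ≤ tensorPairing b S c z y} := by
      ext y; simp
    change IsClosed {y | ∀ z ∈ G.cone (star c), 0 ≤ tensorPairing b S c z y}
    rw [h]
    exact isClosed_biInter fun z _ =>
      isClosed_le continuous_const (IsModuleTopology.continuous_of_linearMap _)
  map_mem φ y hy z hz := by
    rw [tensorPairing_map]
    exact hy _ (G.map_mem _ _ hz)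

end Systems

end ConeSys

end

/-! Contracting the `X` factors sends z in X ⊗ S(a) and y in X ⊗ S(c) to a product z·y in S(a ⊗ c).
By currying, y lies in G^∨ exactly when y·z lies in the intrinsic cone for every z of G at every
level (`mem_dual_iff`). So G ≤ G^∨ says that the elements of G are pairwise compatible, and Zorn's
lemma enlarges them to a maximal compatible family. Maximality makes this family a closed system E
with E ≤ E^∨, and E contains every element of E^∨ that is compatible with itself.

It remains to show E^∨ ≤ E. First, each E(c) spans (`generating`): a vector orthogonal to E(c)
contracts to elements of X ⊗ S(𝟙) ≅ X that are orthogonal to E and self-compatible, since their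
squares are sums of squares; so they lie in E, have square zero and vanish. Hence E(c) contains a
point e at which no nonzero functional nonnegative on E(c) vanishes.

Now let z be in E^∨(c) and move from e towards z. At a point y of E(c) before z, the square y·y is
interior to the intrinsic cone of c ⊗ c, so slightly later points are still self-compatible. They
lie in E^∨, hence in E. As E(c) is closed, the motion reaches z. -/

noncomputable section

namespace ConeSys

universe v u w w₁ w₂

/-! ### Contraction along an orthonormal basis -/

section Contraction

variable {X : Type w} [AddCommGroup X] [Module ℝ X] {d : ℕ} (b : Module.Basis (Fin d) ℝ X)
  {V : Type w₁} [AddCommGroup V] [Module ℝ V] {W : Type w₂} [AddCommGroup W] [Module ℝ W]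

/-- The `i`-th component of an element of `X ⊗ V` with respect to a basis of `X`. -/
def component (V : Type w₁) [AddCommGroup V] [Module ℝ V] (i : Fin d) : X ⊗[ℝ] V →ₗ[ℝ] V :=
  (TensorProduct.lid ℝ V).toLinearMap ∘ₗ (b.coord i).rTensor V

theorem component_tmul (i : Fin d) (x : X) (v : V) :
    component b V i (x ⊗ₜ v) = b.repr x i • v := by
  simp [component]

theorem component_lTensor (f : V →ₗ[ℝ] W) (i : Fin d) (z : X ⊗[ℝ] V) :
    component b W i (f.lTensor X z) = f (component b V i z) := by
  induction z using TensorProduct.induction_on with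
  | zero => simp
  | add y z hy hz => simp only [map_add, hy, hz]
  | tmul x v => simp [component_tmul]

theorem sum_tmul_component (z : X ⊗[ℝ] V) : ∑ i, b i ⊗ₜ[ℝ] component b V i z = z := by
  induction z using TensorProduct.induction_on with
  | zero => simp
  | add y z hy hz => simp only [map_add, tmul_add, Finset.sum_add_distrib, hy, hz]
  | tmul x v =>
    simp only [component_tmul, ← smul_tmul]
    rw [← sum_tmul, b.sum_repr]

theorem eq_zero_of_component_eq_zero (z : X ⊗[ℝ] V) (h : ∀ i, component b V i z = 0) : z = 0 := by
  rw [← sum_tmul_component b z]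
  simp [h]

/-- The contraction `(X ⊗ V) × (X ⊗ W) → V ⊗ W` for the inner product on `X` that makes the
basis `b` orthonormal. -/
def contract (V : Type w₁) [AddCommGroup V] [Module ℝ V] (W : Type w₂) [AddCommGroup W]
    [Module ℝ W] : X ⊗[ℝ] V →ₗ[ℝ] X ⊗[ℝ] W →ₗ[ℝ] V ⊗[ℝ] W :=
  ∑ i, (TensorProduct.mk ℝ V W).compl₁₂ (component b V i) (component b W i)

theorem contract_apply (z : X ⊗[ℝ] V) (y : X ⊗[ℝ] W) :
    contract b V W z y = ∑ i, component b V i z ⊗ₜ[ℝ] component b W i y := by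
  simp [contract, LinearMap.sum_apply]

theorem contract_basis_tmul (i : Fin d) (v : V) (w : W) :
    contract b V W (b i ⊗ₜ v) (b i ⊗ₜ w) = v ⊗ₜ w := by
  rw [contract_apply, Finset.sum_eq_single i]
  · simp [component_tmul]
  · intro j _ hj
    simp [component_tmul, Finsupp.single_eq_of_ne hj]
  · simp

end Contraction

/-! ### Products of elements of X ⊗ S(a) and X ⊗ S(c), and their relation to duality -/

section Systems

variable {C : Type u} [Category.{v} C] [MonoidalCategory C] [SymmetricCategory C]
  [MonoidalClosed C] [StarAutonomousCategory C] (S : Stem C)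
  {X : Type w} [AddCommGroup X] [Module ℝ X] {d : ℕ} (b : Module.Basis (Fin d) ℝ X)

namespace Stem

/-- The multiplication `S a ⊗ S c → S (a ⊗ c)`. -/
abbrev mul (a c : C) : S.obj a ⊗[ℝ] S.obj c →ₗ[ℝ] S.obj (a ⊗ c) :=
  (Functor.LaxMonoidal.μ S.functor a c).hom.hom

theorem mul_bijective (a c : C) : Function.Bijective (S.mul a c) :=
  (FGModuleCat.isoToLinearEquiv (Functor.Monoidal.μIso S.functor a c)).bijective

theorem map_comp_apply {a c e : C} (φ : a ⟶ c) (ψ : c ⟶ e) (v : S.obj a) :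
    S.map (φ ≫ ψ) v = S.map ψ (S.map φ v) :=
  congrArg (fun f => f.hom.hom v) (S.functor.map_comp φ ψ)

theorem map_id_apply (c : C) (v : S.obj c) : S.map (𝟙 c) v = v :=
  congrArg (fun f => f.hom.hom v) (S.functor.map_id c)

theorem map_whiskerRight_mul {a c : C} (φ : a ⟶ c) (e : C) (v : S.obj a) (w : S.obj e) :
    S.map (φ ▷ e) (S.mul a e (v ⊗ₜ w)) = S.mul c e (S.map φ v ⊗ₜ w) :=
  congrArg (fun f => f.hom.hom (v ⊗ₜ[ℝ] w))
    (Functor.LaxMonoidal.μ_natural_left S.functor φ e).symm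

theorem map_whiskerLeft_mul {a c : C} (φ : a ⟶ c) (e : C) (v : S.obj a) (w : S.obj e) :
    S.map (e ◁ φ) (S.mul e a (w ⊗ₜ v)) = S.mul e c (w ⊗ₜ S.map φ v) :=
  congrArg (fun f => f.hom.hom (w ⊗ₜ[ℝ] v))
    (Functor.LaxMonoidal.μ_natural_right S.functor e φ).symm

theorem map_braiding_mul (a c : C) (v : S.obj a) (w : S.obj c) :
    S.map (β_ a c).hom (S.mul a c (v ⊗ₜ w)) = S.mul c a (w ⊗ₜ v) :=
  congrArg (fun f => f.hom.hom (v ⊗ₜ[ℝ] w))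
    (Functor.LaxBraided.braided (F := S.functor) a c)

theorem map_leftUnitor_mul (c : C) (v : S.obj c) :
    S.map (λ_ c).hom (S.mul (𝟙_ C) c (S.one ⊗ₜ v)) = v := by
  have h := congrArg (fun f => f.hom.hom ((1 : ℝ) ⊗ₜ[ℝ] v))
    (Functor.LaxMonoidal.left_unitality S.functor c)
  exact h.symm.trans (one_smul ℝ v)

theorem exists_smul_one (v : S.obj (𝟙_ C)) : ∃ r : ℝ, v = r • S.one := by
  obtain ⟨r, hr⟩ :=
    (FGModuleCat.isoToLinearEquiv (Functor.Monoidal.εIso S.functor)).surjective v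
  refine ⟨r, ?_⟩
  have h := (Functor.LaxMonoidal.ε S.functor).hom.hom.map_smul r (1 : ℝ)
  rw [smul_eq_mul, mul_one] at h
  exact hr.symm.trans h

theorem one_ne_zero : S.one ≠ 0 := by
  intro h
  let e := FGModuleCat.isoToLinearEquiv (Functor.Monoidal.εIso S.functor)
  have h1 : e (1 : ℝ) = e (0 : ℝ) := Eq.trans h (map_zero e).symm
  exact _root_.one_ne_zero (α := ℝ) (e.injective h1)

end Stem

/-- The product `(X ⊗ S a) × (X ⊗ S c) → S a ⊗ S c ≅ S (a ⊗ c)`. -/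
def dot (a c : C) : X ⊗[ℝ] S.obj a →ₗ[ℝ] X ⊗[ℝ] S.obj c →ₗ[ℝ] S.obj (a ⊗ c) :=
  (contract b (S.obj a) (S.obj c)).compr₂ (S.mul a c)

theorem dot_apply (a c : C) (z : X ⊗[ℝ] S.obj a) (y : X ⊗[ℝ] S.obj c) :
    dot S b a c z y = ∑ i, S.mul a c (component b _ i z ⊗ₜ[ℝ] component b _ i y) := by
  simp only [dot, LinearMap.compr₂_apply, contract_apply, map_sum]

theorem map_dot_left {a c : C} (φ : a ⟶ c) (e : C) (z : X ⊗[ℝ] S.obj a) (y : X ⊗[ℝ] S.obj e) :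
    S.map (φ ▷ e) (dot S b a e z y) = dot S b c e ((S.map φ).lTensor X z) y := by
  simp only [dot_apply, map_sum, S.map_whiskerRight_mul, component_lTensor]

theorem map_dot_right {a c : C} (φ : a ⟶ c) (e : C) (z : X ⊗[ℝ] S.obj e) (y : X ⊗[ℝ] S.obj a) :
    S.map (e ◁ φ) (dot S b e a z y) = dot S b e c z ((S.map φ).lTensor X y) := by
  simp only [dot_apply, map_sum, S.map_whiskerLeft_mul, component_lTensor]

theorem map_dot_braiding (a c : C) (z : X ⊗[ℝ] S.obj a) (y : X ⊗[ℝ] S.obj c) :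
    S.map (β_ a c).hom (dot S b a c z y) = dot S b c a y z := by
  simp only [dot_apply, map_sum, S.map_braiding_mul]

theorem toDual_apply_eq_sum (x y : X) : b.toDual x y = ∑ i, b.repr x i * b.repr y i := by
  rw [← b.sum_repr x, map_sum, LinearMap.sum_apply]
  refine Finset.sum_congr rfl fun i _ => ?_
  rw [b.sum_repr, map_smul, LinearMap.smul_apply, b.toDual_apply_right, smul_eq_mul]

theorem tensorPairing_eq_sum (c : C) (z : X ⊗[ℝ] S.obj (star c)) (y : X ⊗[ℝ] S.obj c) :
    tensorPairing b S c z y = ∑ i, S.pairing c (component b _ i z) (component b _ i y) := by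
  induction z using TensorProduct.induction_on with
  | zero => simp
  | add z₁ z₂ h₁ h₂ => simp only [map_add, LinearMap.add_apply, h₁, h₂, Finset.sum_add_distrib]
  | tmul x u =>
    induction y using TensorProduct.induction_on with
    | zero => simp
    | add y₁ y₂ h₁ h₂ => simp only [map_add, h₁, h₂, Finset.sum_add_distrib]
    | tmul y v =>
      simp only [tensorPairing_tmul, component_tmul, map_smul, LinearMap.smul_apply, smul_eq_mul]
      rw [toDual_apply_eq_sum, Finset.sum_mul]
      exact Finset.sum_congr rfl fun i _ => by ring

theorem tensorPairing_eq_dot (c : C) (z : X ⊗[ℝ] S.obj (star c)) (y : X ⊗[ℝ] S.obj c) :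
    tensorPairing b S c z y = S.botEquiv (S.map (starEv c) (dot S b c (star c) y z)) := by
  have h (u : S.obj (star c)) (v : S.obj c) :
      S.botEquiv (S.map (starEv c) (S.mul c (star c) (v ⊗ₜ u))) = S.pairing c u v := rfl
  simp only [dot_apply, map_sum, h, tensorPairing_eq_sum]

/-- Tensor-hom adjunction: testing a product against a morphism to the dualizing object amounts to
pairing with a transported element. This turns duality of systems into compatibility. -/
theorem map_dot_eq_tensorPairing {a c : C} (φ : a ⊗ c ⟶ bot C) (z : X ⊗[ℝ] S.obj a)
    (y : X ⊗[ℝ] S.obj c) :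
    S.botEquiv (S.map φ (dot S b a c z y)) =
      tensorPairing b S a ((S.map (MonoidalClosed.curry φ)).lTensor X y) z := by
  rw [tensorPairing_eq_dot, ← map_dot_right, ← S.map_comp_apply,
    MonoidalClosed.whiskerLeft_curry_ihom_ev_app]

theorem tensorPairing_toBidual (c : C) (z : X ⊗[ℝ] S.obj (star c)) (y : X ⊗[ℝ] S.obj c) :
    tensorPairing b S (star c) ((S.map (toBidual (bot C) c)).lTensor X y) z =
      tensorPairing b S c z y := by
  rw [toBidual, ← map_dot_eq_tensorPairing, S.map_comp_apply, map_dot_braiding,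
    tensorPairing_eq_dot]

theorem exists_tensorPairing_eq (c : C) (f : X ⊗[ℝ] S.obj c →ₗ[ℝ] ℝ) :
    ∃ g, tensorPairing b S c g = f := by
  choose g hg using fun i =>
    (S.bijective_pairing c).2 (f ∘ₗ TensorProduct.mk ℝ X (S.obj c) (b i))
  refine ⟨∑ i, b i ⊗ₜ g i, LinearMap.ext fun y => ?_⟩
  conv_rhs => rw [← sum_tmul_component b y, map_sum]
  rw [tensorPairing_eq_sum]
  refine Finset.sum_congr rfl fun j _ => ?_
  have hj : component b _ j (∑ i, b i ⊗ₜ g i) = g j := by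
    rw [map_sum, Finset.sum_eq_single j]
    · simp [component_tmul]
    · intro i _ hi
      simp [component_tmul, Finsupp.single_eq_of_ne hi.symm]
    · simp
  rw [hj]
  exact LinearMap.congr_fun (hg j) _

/-- With S(𝟙) ≅ ℝ, the square of h is its squared norm in X times the unit, so positive definiteness
applies. -/
theorem eq_zero_of_dot_self (h : X ⊗[ℝ] S.obj (𝟙_ C))
    (h0 : dot S b (𝟙_ C) (𝟙_ C) h h = 0) : h = 0 := by
  choose r hr using fun i => S.exists_smul_one (component b _ i h)
  have h1 := congrArg (S.map (λ_ (𝟙_ C)).hom) h0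
  simp only [dot_apply, hr, smul_tmul_smul, map_smul, S.map_leftUnitor_mul, map_zero,
    ← Finset.sum_smul] at h1
  have h2 := (smul_eq_zero.1 h1).resolve_right S.one_ne_zero
  refine eq_zero_of_component_eq_zero b h fun i => ?_
  have h3 := (Finset.sum_eq_zero_iff_of_nonneg fun j _ => mul_self_nonneg (r j)).1 h2 i
    (Finset.mem_univ i)
  rw [hr, mul_self_eq_zero.1 h3, zero_smul]

/-- The square is a nonnegative multiple of 1 ⊗ 1. This is where the sign normalization of S(bot)
enters. -/
theorem dot_self_mem (hone : S.one ∈ S.intrinsicCone (𝟙_ C)) (h : X ⊗[ℝ] S.obj (𝟙_ C)) :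
    dot S b (𝟙_ C) (𝟙_ C) h h ∈ S.intrinsicCone (𝟙_ C ⊗ 𝟙_ C) := by
  intro φ
  have h1 : S.mul (𝟙_ C) (𝟙_ C) (S.one ⊗ₜ S.one) = S.map (λ_ (𝟙_ C)).inv S.one := by
    conv_rhs => rw [← S.map_leftUnitor_mul (𝟙_ C) S.one, ← S.map_comp_apply, Iso.hom_inv_id,
      S.map_id_apply]
  choose r hr using fun i => S.exists_smul_one (component b _ i h)
  simp only [dot_apply, map_sum, hr, smul_tmul_smul, map_smul, h1, ← S.map_comp_apply]
  exact Finset.sum_nonneg fun i _ => mul_nonneg (mul_self_nonneg _) (hone _)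

/-- Contracting `g` with all linear maps `S a → S 𝟙` detects whether `g = 0`. -/
theorem eq_zero_of_lTensor_eq_zero (b : Module.Basis (Fin d) ℝ X) {a : C} (g : X ⊗[ℝ] S.obj a)
    (hg : ∀ α : S.obj a →ₗ[ℝ] S.obj (𝟙_ C), α.lTensor X g = 0) : g = 0 := by
  refine eq_zero_of_component_eq_zero b g fun i => ?_
  refine (Module.forall_dual_apply_eq_zero_iff ℝ _).1 fun f => ?_
  have h := component_lTensor b (f.smulRight S.one) i g
  rw [hg, map_zero, LinearMap.smulRight_apply] at h
  exact (smul_eq_zero.1 h.symm).resolve_right S.one_ne_zero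

/-- Since α need not come from a morphism of `C`, functoriality is of no help; injectivity of the
multiplication moves the vanishing to S(a) ⊗ S(c), where any linear map can be applied. -/
theorem dot_lTensor_eq_zero {a c : C} (g : X ⊗[ℝ] S.obj a) (e : X ⊗[ℝ] S.obj c)
    (h : dot S b a c g e = 0) (α : S.obj a →ₗ[ℝ] S.obj (𝟙_ C)) :
    dot S b (𝟙_ C) c (α.lTensor X g) e = 0 := by
  have h1 : contract b (S.obj a) (S.obj c) g e = 0 :=
    (S.mul_bijective a c).1 (h.trans (map_zero _).symm)
  have h2 : contract b (S.obj (𝟙_ C)) (S.obj c) (α.lTensor X g) e =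
      α.rTensor (S.obj c) (contract b (S.obj a) (S.obj c) g e) := by
    simp only [contract_apply, component_lTensor, map_sum, LinearMap.rTensor_tmul]
  rw [dot, LinearMap.compr₂_apply, h2, h1, map_zero, map_zero]

end Systems

/-! ### Convexity in finite-dimensional spaces -/

section Convexity

variable {V : Type w} [AddCommGroup V] [Module ℝ V]

theorem isClosedIn_preimage {W : Type*} [AddCommGroup W] [Module ℝ W] (f : V →ₗ[ℝ] W) {s : Set W}
    (hs : IsClosedIn s) : IsClosedIn (f ⁻¹' s) := by
  let _ : TopologicalSpace V := moduleTopology ℝ V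
  let _ : TopologicalSpace W := moduleTopology ℝ W
  have : IsModuleTopology ℝ V := ⟨rfl⟩
  have : IsModuleTopology ℝ W := ⟨rfl⟩
  have : ContinuousAdd W := IsModuleTopology.toContinuousAdd ℝ W
  exact IsClosed.preimage (IsModuleTopology.continuous_of_linearMap f) hs

/-- A closed set that contains `p` and, with each point of the half-open segment from `p` to `q`,
a later point of the segment, contains `q`. -/
theorem mem_of_forall_exists_gt_segment {s : Set V} (hs : IsClosedIn s) (p q : V) (hp : p ∈ s)
    (h : ∀ t ∈ Set.Ico (0 : ℝ) 1, p + t • (q - p) ∈ s →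
      ∃ t' ∈ Set.Ioc t 1, p + t' • (q - p) ∈ s) : q ∈ s := by
  let _ : TopologicalSpace V := moduleTopology ℝ V
  have : IsModuleTopology ℝ V := ⟨rfl⟩
  have : ContinuousAdd V := IsModuleTopology.toContinuousAdd ℝ V
  have hc : IsClosed ((fun t : ℝ => p + t • (q - p)) ⁻¹' s) :=
    IsClosed.preimage (by fun_prop) hs
  have h1 := (hc.inter isClosed_Icc).mem_of_ge_of_forall_exists_gt (a := (0 : ℝ)) (b := 1)
    (by simpa using hp) zero_le_one fun t ht => by
      obtain ⟨t', ht', hm⟩ := h t ht.2 ht.1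
      exact ⟨t', hm, ht'⟩
  simpa using h1

/-- A vector at which no nonzero functional that is nonnegative on the proper cone `K` is
nonpositive, is an interior point of `K`. -/
theorem IsProperCone.exists_quadratic_mem {K : PointedCone ℝ V} (hK : IsProperCone K) (x : V)
    (hx : ∀ f : V →ₗ[ℝ] ℝ, (∀ a ∈ K, 0 ≤ f a) → f x ≤ 0 → f = 0) (y z : V) :
    ∃ ε > 0, ∀ t ∈ Set.Icc (0 : ℝ) ε, x + t • y + t ^ 2 • z ∈ K := by
  let _ : TopologicalSpace V := moduleTopology ℝ V
  have : IsModuleTopology ℝ V := ⟨rfl⟩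
  have : ContinuousAdd V := IsModuleTopology.toContinuousAdd ℝ V
  have : IsTopologicalAddGroup V := IsModuleTopology.topologicalAddGroup ℝ V
  have hconv : Convex ℝ (K : Set V) := PointedCone.convex K
  have hint : x ∈ interior (K : Set V) := by
    by_contra hxn
    obtain ⟨f, hf⟩ := geometric_hahn_banach_open_point hconv.interior isOpen_interior hxn
    obtain ⟨a₀, ha₀⟩ : (interior (K : Set V)).Nonempty := hK.interior_nonempty
    have hle (k : V) (hk : k ∈ K) : f k ≤ f x := by
      have hk' : k ∈ closure (interior (K : Set V)) := by
        rw [hconv.closure_interior_eq_closure_of_nonempty_interior hK.interior_nonempty]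
        exact subset_closure hk
      exact closure_minimal (t := {a | f a ≤ f x}) (fun a ha => (hf a ha).le)
        (isClosed_le f.continuous continuous_const) hk'
    have hx0 : 0 ≤ f x := by simpa using hle 0 K.zero_mem
    have hnonpos (k : V) (hk : k ∈ K) : f k ≤ 0 := by
      by_contra! hpos
      -- This multiple of k stays in the cone but has value f x + 1, above the bound f x.
      have hr : 0 ≤ (f x + 1) / f k := by positivity
      have := hle _ (K.smul_mem hr hk)
      rw [map_smul, smul_eq_mul, div_mul_cancel₀ _ hpos.ne'] at this
      linarith
    have h0 := hx (-f.toLinearMap) (fun a ha => by simpa using hnonpos a ha) (by simpa using hx0)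
    have h1 (v : V) : f v = 0 := by simpa using LinearMap.congr_fun h0 v
    have := hf a₀ ha₀
    rw [h1, h1] at this
    exact lt_irrefl _ this
  have hopen : IsOpen ((fun t : ℝ => x + t • y + t ^ 2 • z) ⁻¹' interior (K : Set V)) :=
    isOpen_interior.preimage (by fun_prop)
  obtain ⟨ε, hε, hball⟩ := Metric.isOpen_iff.1 hopen 0 (by simpa using hint)
  refine ⟨ε / 2, half_pos hε, fun t ht => interior_subset (hball ?_)⟩
  rw [Metric.mem_ball, Real.dist_0_eq_abs, abs_of_nonneg ht.1]
  linarith [ht.2]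

/-- A generating cone contains a point at which no nonzero nonnegative functional vanishes. -/
theorem exists_mem_forall_eq_zero [Module.Finite ℝ V] (K : PointedCone ℝ V)
    (hK : ∀ f : V →ₗ[ℝ] ℝ, (∀ a ∈ K, f a = 0) → f = 0) :
    ∃ e ∈ K, ∀ f : V →ₗ[ℝ] ℝ, (∀ a ∈ K, 0 ≤ f a) → f e = 0 → f = 0 := by
  have hspan : Submodule.span ℝ (K : Set V) = ⊤ := by
    by_contra hne
    obtain ⟨f, hf0, hf⟩ := Submodule.exists_le_ker_of_lt_top _ (lt_top_iff_ne_top.2 hne)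
    exact hf0 (hK f fun a ha => hf (Submodule.subset_span ha))
  obtain ⟨s, hsK, hs⟩ := (Submodule.fg_span_iff_fg_span_finset_subset (K : Set V)).1
    (hspan ▸ Module.Finite.fg_top)
  -- A nonnegative functional vanishing on the sum of a finite spanning subset of K vanishes on each
  -- summand.
  refine ⟨∑ a ∈ s, a, K.sum_mem fun a ha => hsK ha, fun f hf h0 => hK f fun a ha => ?_⟩
  rw [map_sum, Finset.sum_eq_zero_iff_of_nonneg fun a ha => hf a (hsK ha)] at h0
  have hker : Submodule.span ℝ (K : Set V) ≤ LinearMap.ker f := by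
    rw [hs, Submodule.span_le]
    exact h0
  exact hker (Submodule.subset_span ha)

end Convexity

/-! ### Maximal compatible families -/

section Systems

variable {C : Type u} [Category.{v} C] [MonoidalCategory C] [SymmetricCategory C]
  [MonoidalClosed C] [StarAutonomousCategory C] (S : Stem C)
  {X : Type w} [AddCommGroup X] [Module ℝ X] {d : ℕ} (b : Module.Basis (Fin d) ℝ X)

theorem Stem.map_mem_intrinsicCone {a c : C} (φ : a ⟶ c) {v : S.obj a}
    (hv : v ∈ S.intrinsicCone a) : S.map φ v ∈ S.intrinsicCone c := fun ψ => by
  rw [← S.map_comp_apply]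
  exact hv _

/-- Two elements are compatible if their product lies in the intrinsic cone. -/
def Compatible {a c : C} (z : X ⊗[ℝ] S.obj a) (y : X ⊗[ℝ] S.obj c) : Prop :=
  dot S b a c z y ∈ S.intrinsicCone (a ⊗ c)

variable {S b}

theorem Compatible.symm {a c : C} {z : X ⊗[ℝ] S.obj a} {y : X ⊗[ℝ] S.obj c}
    (h : Compatible S b z y) : Compatible S b y z := by
  have := S.map_mem_intrinsicCone (β_ a c).hom h
  rwa [map_dot_braiding] at this

theorem Compatible.map {a c e : C} {z : X ⊗[ℝ] S.obj a} {y : X ⊗[ℝ] S.obj e}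
    (h : Compatible S b z y) (φ : a ⟶ c) : Compatible S b ((S.map φ).lTensor X z) y := by
  have := S.map_mem_intrinsicCone (φ ▷ e) h
  rwa [map_dot_left] at this

theorem Compatible.add {a e : C} {z z' : X ⊗[ℝ] S.obj a} {y : X ⊗[ℝ] S.obj e}
    (h : Compatible S b z y) (h' : Compatible S b z' y) : Compatible S b (z + z') y := by
  rw [Compatible, map_add, LinearMap.add_apply]
  exact add_mem h h'

theorem Compatible.smul {a e : C} {z : X ⊗[ℝ] S.obj a} {y : X ⊗[ℝ] S.obj e}
    (h : Compatible S b z y) {r : ℝ} (hr : 0 ≤ r) : Compatible S b (r • z) y := by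
  rw [Compatible, map_smul, LinearMap.smul_apply]
  exact PointedCone.smul_mem _ hr h

theorem compatible_zero {a e : C} (y : X ⊗[ℝ] S.obj e) :
    Compatible S b (0 : X ⊗[ℝ] S.obj a) y := by
  rw [Compatible, map_zero, LinearMap.zero_apply]
  exact zero_mem _

theorem isClosedIn_setOf_compatible (hproper : ∀ c : C, IsProperCone (S.intrinsicCone c))
    (a : C) {c : C} (y : X ⊗[ℝ] S.obj c) :
    IsClosedIn {z : X ⊗[ℝ] S.obj a | Compatible S b z y} :=
  isClosedIn_preimage ((dot S b a c).flip y) (hproper (a ⊗ c)).closed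

variable (S b) in
/-- A set of elements of the spaces `X ⊗ S c` that are pairwise compatible (in particular each
one is compatible with itself). -/
def IsCompatibleSet (F : Set (Σ c : C, X ⊗[ℝ] S.obj c)) : Prop :=
  ∀ p ∈ F, ∀ q ∈ F, Compatible S b p.2 q.2

theorem exists_maximal_isCompatibleSet {F : Set (Σ c : C, X ⊗[ℝ] S.obj c)}
    (hF : IsCompatibleSet S b F) : ∃ M, F ⊆ M ∧ Maximal (IsCompatibleSet S b) M := by
  refine zorn_subset_nonempty {F | IsCompatibleSet S b F} (fun c hc hchain hne => ?_) F hF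
  refine ⟨⋃₀ c, ?_, fun s hs => Set.subset_sUnion_of_mem hs⟩
  rintro p ⟨s, hs, hp⟩ q ⟨t, ht, hq⟩
  rcases hchain.total hs ht with h | h
  · exact hc ht p (h hp) q hq
  · exact hc hs p hp q (h hq)

section Maximal

variable {M : Set (Σ c : C, X ⊗[ℝ] S.obj c)} (hM : Maximal (IsCompatibleSet S b) M)

include hM

theorem mem_of_compatible {c : C} {y : X ⊗[ℝ] S.obj c} (hy : ∀ q ∈ M, Compatible S b y q.2)
    (hyy : Compatible S b y y) : (⟨c, y⟩ : Σ c : C, X ⊗[ℝ] S.obj c) ∈ M := by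
  refine hM.le_of_ge (y := insert ⟨c, y⟩ M) ?_ (Set.subset_insert _ _) (Set.mem_insert _ _)
  rintro p (rfl | hp) q (rfl | hq)
  · exact hyy
  · exact hy q hq
  · exact (hy p hp).symm
  · exact hM.prop p hp q hq

/-- The system of cones given by a maximal set of pairwise compatible elements. -/
def coneSystemOfMaximal (hproper : ∀ c : C, IsProperCone (S.intrinsicCone c)) :
    ConeSystem S X where
  cone c :=
    { carrier := {y | (⟨c, y⟩ : Σ c : C, X ⊗[ℝ] S.obj c) ∈ M}
      zero_mem' := mem_of_compatible hM (fun _ _ => compatible_zero _) (compatible_zero _)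
      add_mem' := by
        intro y z hy hz
        have h q (hq : q ∈ M) : Compatible S b (y + z) q.2 :=
          (hM.prop _ hy q hq).add (hM.prop _ hz q hq)
        -- Since y and z themselves belong to M, the sum is compatible with each of them, hence with
        -- itself.
        exact mem_of_compatible hM h ((h _ hy).symm.add (h _ hz).symm)
      smul_mem' := by
        intro r y hy
        have h q (hq : q ∈ M) : Compatible S b ((r : ℝ) • y) q.2 := (hM.prop _ hy q hq).smul r.2
        exact mem_of_compatible hM h ((h _ hy).symm.smul r.2) }
  isClosed_cone c := by
    let _ : TopologicalSpace (X ⊗[ℝ] S.obj c) := moduleTopology ℝ _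
    change IsClosed {y | (⟨c, y⟩ : Σ c : C, X ⊗[ℝ] S.obj c) ∈ M}
    refine isClosed_of_closure_subset fun y hy => ?_
    have hclosed {e : C} (z : X ⊗[ℝ] S.obj e) :
        IsClosed {y : X ⊗[ℝ] S.obj c | Compatible S b y z} :=
      isClosedIn_setOf_compatible hproper c z
    have h q (hq : q ∈ M) : Compatible S b y q.2 :=
      closure_minimal (fun z hz => hM.prop ⟨c, z⟩ hz q hq) (hclosed q.2) hy
    exact mem_of_compatible hM h
      (closure_minimal (fun z hz => (h ⟨c, z⟩ hz).symm) (hclosed y) hy)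
  map_mem φ y hy := by
    have h q (hq : q ∈ M) : Compatible S b ((S.map φ).lTensor X y) q.2 := (hM.prop _ hy q hq).map φ
    exact mem_of_compatible hM h ((h _ hy).symm.map φ)

end Maximal

/-- The dual tests y only against G(c*), but currying a morphism c ⊗ e ⟶ bot carries G(e) into
G(c*), so all levels are covered. -/
theorem mem_dual_iff (G : ConeSystem S X) {c : C} {y : X ⊗[ℝ] S.obj c} :
    y ∈ (G.dual b).cone c ↔ ∀ e : C, ∀ z ∈ G.cone e, Compatible S b y z := by
  refine ⟨fun hy e z hz φ => ?_, fun h z hz => ?_⟩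
  · rw [map_dot_eq_tensorPairing]
    exact hy _ (G.map_mem _ z hz)
  · rw [tensorPairing_eq_dot]
    exact h _ z hz _

variable (b) in
/-- A system of pairwise compatible elements to which no compatible element can be added. -/
structure IsMaximalCompatible (E : ConeSystem S X) : Prop where
  le_dual : E ≤ E.dual b
  mem_of_mem_dual : ∀ {c : C} {y : X ⊗[ℝ] S.obj c}, y ∈ (E.dual b).cone c →
    Compatible S b y y → y ∈ E.cone c

theorem exists_isMaximalCompatible (hproper : ∀ c : C, IsProperCone (S.intrinsicCone c))
    (G : ConeSystem S X) (hG : G ≤ G.dual b) :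
    ∃ E : ConeSystem S X, G ≤ E ∧ IsMaximalCompatible b E := by
  obtain ⟨M, hGM, hM⟩ := exists_maximal_isCompatibleSet (S := S) (b := b)
    (F := {p | p.2 ∈ G.cone p.1}) fun p hp q hq => (mem_dual_iff G).1 (hG _ hp) _ _ hq
  refine ⟨coneSystemOfMaximal hM hproper, fun c y hy => hGM hy, fun c y hy => ?_,
    fun hy hyy => ?_⟩
  · exact (mem_dual_iff _).2 fun e z hz => hM.prop _ hy _ hz
  · exact mem_of_compatible hM (fun q hq => (mem_dual_iff _).1 hy q.1 q.2 hq) hyy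

/-! ### Maximal compatible systems are self-dual -/

namespace IsMaximalCompatible

variable {E : ConeSystem S X} (hE : IsMaximalCompatible b E)

include hE

theorem generating (hproper : ∀ c : C, IsProperCone (S.intrinsicCone c))
    (hone : S.one ∈ S.intrinsicCone (𝟙_ C)) (c : C) (f : X ⊗[ℝ] S.obj c →ₗ[ℝ] ℝ)
    (hf : ∀ y ∈ E.cone c, f y = 0) : f = 0 := by
  obtain ⟨g, rfl⟩ := exists_tensorPairing_eq S b c f
  suffices hg : g = 0 by rw [hg, map_zero]
  have hdot (e : C) (y : X ⊗[ℝ] S.obj e) (hy : y ∈ E.cone e) : dot S b (star c) e g y = 0 := by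
    have h (φ : star c ⊗ e ⟶ bot C) : S.botEquiv (S.map φ (dot S b (star c) e g y)) = 0 := by
      have := StarAutonomousCategory.isIso_toBidual (C := C) c
      -- The curried morphism ends in the bidual of c; factoring it through c lets the orthogonality
      -- of g to E(c) apply.
      have hφ : MonoidalClosed.curry φ =
          (MonoidalClosed.curry φ ≫ inv (toBidual (bot C) c)) ≫ toBidual (bot C) c := by simp
      rw [map_dot_eq_tensorPairing, hφ]
      have hcomp : (S.map ((MonoidalClosed.curry φ ≫ inv (toBidual (bot C) c)) ≫
          toBidual (bot C) c)).lTensor X y = (S.map (toBidual (bot C) c)).lTensor X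
            ((S.map (MonoidalClosed.curry φ ≫ inv (toBidual (bot C) c))).lTensor X y) := by
        rw [← LinearMap.lTensor_comp_apply]
        congr 2
        exact LinearMap.ext fun v => S.map_comp_apply _ _ v
      rw [hcomp, tensorPairing_toBidual]
      exact hf _ (E.map_mem _ y hy)
    -- The product and its negative both lie in the intrinsic cone.
    refine (hproper _).sharp _ (fun φ => (h φ).ge) fun φ => ?_
    rw [map_neg, map_neg, h, neg_zero]
  refine eq_zero_of_lTensor_eq_zero S b g fun α => eq_zero_of_dot_self S b _ ?_
  refine dot_lTensor_eq_zero S b _ _ (hdot _ _ ?_) α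
  -- The contraction of g along α is itself an element of E, so its product with g vanishes;
  -- contracting once more along α shows that its square vanishes.
  refine hE.mem_of_mem_dual ((mem_dual_iff E).2 fun e z hz => ?_) (dot_self_mem S b hone _)
  rw [Compatible, dot_lTensor_eq_zero S b _ _ (hdot e z hz)]
  exact zero_mem _

theorem dual_le (hproper : ∀ c : C, IsProperCone (S.intrinsicCone c))
    (hone : S.one ∈ S.intrinsicCone (𝟙_ C)) : E.dual b ≤ E := by
  intro c z hz
  -- For X = 0 the products would not span S(c ⊗ c), so this case is separate; otherwise a single
  -- basis vector of X already produces all pure tensors.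
  obtain hd | ⟨⟨i⟩⟩ := isEmpty_or_nonempty (Fin d)
  · rw [eq_zero_of_component_eq_zero b z isEmptyElim]
    exact zero_mem _
  have hXfin : Module.Finite ℝ X := Module.Finite.of_basis b
  obtain ⟨e, he, hzero⟩ := exists_mem_forall_eq_zero (E.cone c) (hE.generating hproper hone c)
  have he' := hE.le_dual c he
  refine mem_of_forall_exists_gt_segment (E.isClosed_cone c) e z he fun t ht hy => ?_
  set y := e + t • (z - e) with hydef
  have hy' : y = (1 - t) • e + t • z := by rw [hydef]; module
  have hpos : ∀ f : S.obj (c ⊗ c) →ₗ[ℝ] ℝ, (∀ v ∈ S.intrinsicCone (c ⊗ c), 0 ≤ f v) →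
      f (dot S b c c y y) ≤ 0 → f = 0 := by
    intro f hf hfy
    have hcomp {u w} (hu : u ∈ (E.dual b).cone c) (hw : w ∈ E.cone c) :
        0 ≤ f (dot S b c c u w) := hf _ ((mem_dual_iff E).1 hu c w hw)
    have hcomp' {u w} (hu : u ∈ (E.dual b).cone c) (hw : w ∈ E.cone c) :
        0 ≤ f (dot S b c c w u) := hf _ ((mem_dual_iff E).1 hu c w hw).symm
    -- As t < 1, the expansion of f(y·y) ≤ 0 into nonnegative terms gives e a positive weight; the
    -- same holds for f(y·e) in the next step.
    have hye : f (dot S b c c y e) = 0 := by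
      have h1 := hcomp (hE.le_dual c hy) he
      have h2 := hcomp' hz hy
      have h3 : f (dot S b c c y y) =
          (1 - t) * f (dot S b c c y e) + t * f (dot S b c c y z) := by
        rw [← smul_eq_mul, ← smul_eq_mul, ← map_smul, ← map_smul, ← map_smul, ← map_smul,
          ← map_add, ← map_add, ← hy']
      nlinarith [mul_nonneg ht.1 h2, ht.2]
    have hee : f (dot S b c c e e) = 0 := by
      have h1 := hcomp he' he
      have h2 := hcomp hz he
      rw [hy'] at hye
      simp only [map_add, map_smul, LinearMap.add_apply, LinearMap.smul_apply, smul_eq_mul] at hye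
      nlinarith [mul_nonneg ht.1 h2, ht.2]
    -- By the choice of e, vanishing at e spreads first over the left factor, then over the right
    -- one.
    have hue (u) : f (dot S b c c u e) = 0 :=
      LinearMap.congr_fun (hzero (f ∘ₗ (dot S b c c).flip e)
        (fun a ha => hcomp (hE.le_dual c ha) he) hee) u
    have huw (u) (hu : u ∈ E.cone c) (w) : f (dot S b c c u w) = 0 :=
      LinearMap.congr_fun (hzero (f ∘ₗ dot S b c c u)
        (fun a ha => hcomp (hE.le_dual c hu) ha) (hue u)) w
    have hall (u w) : f (dot S b c c u w) = 0 :=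
      LinearMap.congr_fun (hE.generating hproper hone c (f ∘ₗ (dot S b c c).flip w)
        fun a ha => huw a ha w) u
    refine LinearMap.ext fun v => ?_
    obtain ⟨v, rfl⟩ := (S.mul_bijective c c).2 v
    refine LinearMap.congr_fun (TensorProduct.ext' (g := f ∘ₗ S.mul c c) (h := 0)
      fun v w => ?_) v
    have h := hall (b i ⊗ₜ v) (b i ⊗ₜ w)
    rwa [dot, LinearMap.compr₂_apply, contract_basis_tmul] at h
  obtain ⟨ε, hε, hmem⟩ := (hproper (c ⊗ c)).exists_quadratic_mem _ hpos
    (dot S b c c y (z - e) + dot S b c c (z - e) y) (dot S b c c (z - e) (z - e))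
  -- The bound ε keeps the square in the cone, and 1 - t keeps the new point between e and z, hence
  -- in the dual.
  have hδ : 0 < min ε (1 - t) := lt_min hε (by linarith [ht.2])
  refine ⟨t + min ε (1 - t), ⟨by linarith, by linarith [min_le_right ε (1 - t)]⟩, ?_⟩
  set s := min ε (1 - t)
  have h1 : e + (t + s) • (z - e) = y + s • (z - e) := by rw [hydef]; module
  have h2 : e + (t + s) • (z - e) = (1 - (t + s)) • e + (t + s) • z := by module
  refine hE.mem_of_mem_dual ?_ ?_
  · rw [h2]
    have hs : s ≤ 1 - t := min_le_right _ _
    exact add_mem (PointedCone.smul_mem _ (by linarith) he')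
      (PointedCone.smul_mem _ (by linarith [ht.1]) hz)
  · rw [h1, Compatible]
    convert hmem s ⟨hδ.le, min_le_left _ _⟩ using 1
    simp only [map_add, map_smul, LinearMap.add_apply, LinearMap.smul_apply]
    module

end IsMaximalCompatible

end Systems

end ConeSys

end

theorem mainTheorem1
    {C : Type*} [Category C] [MonoidalCategory C] [SymmetricCategory C] [MonoidalClosed C]
    [ConeSys.StarAutonomousCategory C] (S : ConeSys.Stem C)
    (hproper : ∀ c : C, ConeSys.IsProperCone (S.intrinsicCone c))
    (hone : S.one ∈ S.intrinsicCone (𝟙_ C))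
    {X : Type*} [AddCommGroup X] [Module ℝ X] {d : ℕ} (b : Module.Basis (Fin d) ℝ X)
    (G : ConeSys.ConeSystem S X) (hG : G ≤ G.dual b) :
    ∃ E : ConeSys.ConeSystem S X, G ≤ E ∧ E = E.dual b ∧ E.dual b ≤ G.dual b := by
  obtain ⟨E, hGE, hE⟩ := ConeSys.exists_isMaximalCompatible hproper G hG
  refine ⟨E, hGE, ?_, fun c y hy z hz => hy z (hGE _ hz)⟩
  exact ConeSys.ConeSystem.ext
    (funext fun c => le_antisymm (hE.le_dual c) (hE.dual_le hproper hone c))
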